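/- Let $\mathbf{Met}$ be the category of extended metric spaces (the distance $\infty$ is allowed) and nonexpanding maps. A metric-enriched category is a category $\mathcal{K}$ with an extended metric on every hom-set $\mathcal{K}(X,Y)$ such that $d(g f, g' f') \le d(f,f') + d(g,g')$ for all $f,f'\colon X\to Y$ and $g,g'\colon Y\to Z$. Weighted colimits are understood in the sense of enrichment over $\mathbf{Met}$; ordinary colimits, such as coequalizers, are conical, i.e. weighted by the constant weight with value the one-point space. An object $G$ of $\mathcal{K}$ has tensors if for every space $M$ there is an object $M\otimes G$ with isomorphisms of metric spaces $\mathcal{K}(M\otimes G,X)\cong\mathbf{Met}(M,\mathcal{K}(G,X))$, natural in $X$, where $\mathbf{Met}(M,N)$ carries the supremum metric. For a set $S$, considered as a discrete space (all distances $0$ or $\infty$), $S\otimes G$ is the copower $\coprod_S G$. A morphism $e\colon X\to Y$ is a subregular epimorphism if it is the colimit map of a basic diagram: $\mathcal{B}$ is the (discretely enriched) category obtained from the chain of all real numbers $\varepsilon\ge 0$ by adding an object $a$ and two cocones $l_\varepsilon, r_\varepsilon\colon\varepsilon\to a$; the basic weight $B\colon\mathcal{B}^{\mathrm{op}}\to\mathbf{Met}$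 has $Ba=\{*\}$, $B\varepsilon=\{0,1\}$ with $d(0,1)=\varepsilon$ (the two points being identified if $\varepsilon=0$), is carried by the identity of $\{0,1\}$ on $\varepsilon\to\varepsilon'$, and $Bl_\varepsilon$, $Br_\varepsilon$ pick out $0$ and $1$; the colimit map of a diagram $D\colon\mathcal{B}\to\mathcal{K}$ with $Da=X$ and colimit $Y$ weighted by $B$ is the morphism $Da\to Y$ which is the value at $*$ of the $a$-component of the unit $B\to\mathcal{K}(D-,Y)$. An object $G$ with tensors is a subvarietal generator if 1. for every object $X$ the evaluation morphism $\mathcal{K}(G,X)\otimes G\to X$ corresponding to $\mathrm{id}_{\mathcal{K}(G,X)}$ is a subregular epimorphism; 2. $G$ is abstractly finite: for every set $S$, every morphism $G\to\coprod_S G$ factorizes through $\coprod_{S'}G$ for some finite subset $S'\subseteq S$; 3. $G$ is a subregular projective: for every subregular epimorphism $e\colon X\to Y$ every morphism $G\to Y$ factorizes through $e$. Theorem. Let $\mathcal{K}$ be a metric-enriched category with coequalizers of reflexive pairs and with a subvarietal generator $G$. Let $\mathcal{A}$ be the full subcategory of $\mathcal{K}$ on all finite copowers $n\otimes G=\coprod_n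 G$ ($n\in\mathbb{N}$) of $G$. Then $\mathcal{A}$ is dense in $\mathcal{K}$. That is, let $[\mathcal{A}^{\mathrm{op}},\mathbf{Met}]$ be the category of locally nonexpanding functors and natural transformations, with $d(\sigma,\tau)=\sup_{A} d(\sigma_A,\tau_A)$. Then the functor $E\colon\mathcal{K}\to[\mathcal{A}^{\mathrm{op}},\mathbf{Met}]$ which assigns to $K$ the restriction of $\mathcal{K}(-,K)$ to $\mathcal{A}^{\mathrm{op}}$ is full and satisfies $d(f,f')=d(Ef,Ef')$ for all parallel pairs $f,f'$ in $\mathcal{K}$. -/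

import Mathlib

open CategoryTheory Opposite
open scoped NNReal ENNReal

universe v u v₁ u₁

namespace MetCat

/-! ### The category of extended metric spaces and nonexpanding maps -/

/-- Extended metric spaces: the distance `∞` is allowed, and points at distance `0` are equal.
(The topology and the uniformity carried by Mathlib's class are determined by the metric.) -/
structure Met : Type (v + 1) where
  carrier : Type v
  [str : EMetricSpace carrier]

namespace Met

instance : CoeSort Met.{v} (Type v) := ⟨Met.carrier⟩

instance (M : Met.{v}) : EMetricSpace M := M.str

/-- Nonexpanding maps. -/
@[ext]
structure Hom (M N : Met.{v}) : Type v where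
  toFun : M → N
  nonexpanding : ∀ x y : M, edist (toFun x) (toFun y) ≤ edist x y

instance : Category.{v} Met.{v} where
  Hom := Hom
  id M := ⟨fun x => x, fun _ _ => le_rfl⟩
  comp f g := ⟨fun x => g.toFun (f.toFun x),
    fun x y => (g.nonexpanding _ _).trans (f.nonexpanding x y)⟩

@[ext]
theorem hom_ext {M N : Met.{v}} {f g : M ⟶ N} (h : ∀ x, f.toFun x = g.toFun x) : f = g :=
  Hom.ext (funext h)

open scoped Classical in
/-- A set as a discrete space: all distances are `0` or `∞`. -/
noncomputable def discrete (S : Type v) : Met.{v} where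
  carrier := S
  str :=
    { edist := fun x y => if x = y then (0 : ℝ≥0∞) else ⊤
      edist_self := fun x => by simp
      edist_comm := fun x y => by simp only [eq_comm]
      edist_triangle := fun x y z => by
        by_cases h : x = y
        · subst h; simp
        · simp [h]
      eq_of_edist_eq_zero := fun {x y} h => by
        by_contra hne
        simp [hne] at h }

/-- Every map from a set to a space is nonexpanding on the discrete space. -/
def ofDiscrete {S : Type v} {M : Met.{v}} (i : S → M) : discrete S ⟶ M where
  toFun := i
  nonexpanding x y := by
    classical
    by_cases h : x = y
    · subst h; simp
    · exact le_top.trans_eq (if_neg h).symm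

/-- The one-point space. -/
noncomputable def point : Met.{v} := discrete PUnit.{v + 1}

/-- The metric reflection of a pseudometric space: points at distance `0` are identified. -/
noncomputable def reflection (X : Type v) [PseudoEMetricSpace X] : Met.{v} where
  carrier := SeparationQuotient X

/-- Nonexpanding maps between pseudometric spaces induce maps of the metric reflections. -/
noncomputable def reflectionMap {X Y : Type v} [PseudoEMetricSpace X] [PseudoEMetricSpace Y]
    (f : X → Y) (hf : ∀ x y, edist (f x) (f y) ≤ edist x y) : reflection X ⟶ reflection Y where
  toFun := SeparationQuotient.lift (fun x => SeparationQuotient.mk (f x)) (fun x y h =>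
    SeparationQuotient.mk_eq_mk.2 (EMetric.inseparable_iff.2
      (le_antisymm ((hf x y).trans (EMetric.inseparable_iff.1 h).le) zero_le)))
  nonexpanding x y := by
    induction x using Quotient.inductionOn with | _ x =>
    induction y using Quotient.inductionOn with | _ y =>
    exact hf x y

theorem reflectionMap_id (X : Type v) [PseudoEMetricSpace X] :
    reflectionMap (fun x : X => x) (fun _ _ => le_rfl) = 𝟙 (reflection X) :=
  Met.hom_ext fun x => Quotient.inductionOn x fun _ => rfl

theorem reflectionMap_comp {X Y Z : Type v} [PseudoEMetricSpace X] [PseudoEMetricSpace Y]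
    [PseudoEMetricSpace Z] (f : X → Y) (hf : ∀ x y, edist (f x) (f y) ≤ edist x y)
    (g : Y → Z) (hg : ∀ x y, edist (g x) (g y) ≤ edist x y) :
    reflectionMap (fun x => g (f x)) (fun x y => (hg _ _).trans (hf x y)) =
      reflectionMap f hf ≫ reflectionMap g hg :=
  Met.hom_ext fun x => Quotient.inductionOn x fun _ => rfl

end Met

/-! ### Metric-enriched categories -/

/-- A metric-enriched category: every hom-set carries an extended metric such that composition is
nonexpanding with respect to the addition metric. -/
class MetEnriched (K : Type u) [Category.{v} K] where
  homMetric (X Y : K) : EMetricSpace (X ⟶ Y)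
  edist_comp_le {X Y Z : K} (f f' : X ⟶ Y) (g g' : Y ⟶ Z) :
    edist (f ≫ g) (f' ≫ g') ≤ edist f f' + edist g g'

attribute [reducible, instance] MetEnriched.homMetric

/-- `Met` is enriched over itself by the supremum metric. -/
noncomputable instance : MetEnriched Met.{v} where
  homMetric M N :=
    { edist := fun f g => ⨆ x : M, edist (f.toFun x) (g.toFun x)
      edist_self := fun f => by simp
      edist_comm := fun f g => by simp only [edist_comm]
      edist_triangle := fun f g h => iSup_le fun x =>
        (edist_triangle _ (g.toFun x) _).trans (add_le_add
          (le_iSup (fun x => edist (f.toFun x) (g.toFun x)) x)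
          (le_iSup (fun x => edist (g.toFun x) (h.toFun x)) x))
      eq_of_edist_eq_zero := fun {f g} h => by
        ext x
        have h' : (⨆ x : M, edist (f.toFun x) (g.toFun x)) = 0 := h
        rw [ENNReal.iSup_eq_zero] at h'
        exact edist_eq_zero.1 (h' x) }
  edist_comp_le {M N P} f f' g g' := iSup_le fun x =>
    (edist_triangle _ (g.toFun (f'.toFun x)) _).trans (add_le_add
      ((g.nonexpanding _ _).trans (le_iSup (fun x => edist (f.toFun x) (f'.toFun x)) x))
      (le_iSup (fun y => edist (g.toFun y) (g'.toFun y)) (f'.toFun x)))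

/-- A full subcategory of an enriched category is enriched by the same distances. -/
instance {K : Type u} [Category.{v} K] [MetEnriched K] (P : ObjectProperty K) :
    MetEnriched P.FullSubcategory where
  homMetric X Y := EMetricSpace.induced (fun f : X ⟶ Y => f.hom)
    (fun _ _ h => ObjectProperty.hom_ext P h) (MetEnriched.homMetric X.obj Y.obj)
  edist_comp_le f f' g g' := MetEnriched.edist_comp_le f.hom f'.hom g.hom g'.hom

/-- The opposite of an enriched category. -/
instance {K : Type u} [Category.{v} K] [MetEnriched K] : MetEnriched Kᵒᵖ where
  homMetric X Y := EMetricSpace.induced (fun f : X ⟶ Y => f.unop)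
    Quiver.Hom.unop_inj (MetEnriched.homMetric Y.unop X.unop)
  edist_comp_le f f' g g' := by
    rw [add_comm]
    exact MetEnriched.edist_comp_le g.unop g'.unop f.unop f'.unop

/-- Natural transformations between functors into an enriched category carry the metric
`d(σ, τ) = sup_X d(σ_X, τ_X)`. -/
noncomputable instance {C : Type u₁} [Category.{v₁} C] {K : Type u} [Category.{v} K]
    [MetEnriched K] : MetEnriched (C ⥤ K) where
  homMetric F F' :=
    { edist := fun σ τ => ⨆ X : C, edist (σ.app X) (τ.app X)
      edist_self := fun σ => by simp
      edist_comm := fun σ τ => by simp only [edist_comm]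
      edist_triangle := fun σ τ ρ => iSup_le fun X =>
        (edist_triangle _ (τ.app X) _).trans (add_le_add
          (le_iSup (fun X => edist (σ.app X) (τ.app X)) X)
          (le_iSup (fun X => edist (τ.app X) (ρ.app X)) X))
      eq_of_edist_eq_zero := fun {σ τ} h => by
        ext X
        have h' : (⨆ X : C, edist (σ.app X) (τ.app X)) = 0 := h
        rw [ENNReal.iSup_eq_zero] at h'
        exact edist_eq_zero.1 (h' X) }
  edist_comp_le σ σ' τ τ' := iSup_le fun X =>
    (MetEnriched.edist_comp_le _ _ _ _).trans (add_le_add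
      (le_iSup (fun X => edist (σ.app X) (σ'.app X)) X)
      (le_iSup (fun X => edist (τ.app X) (τ'.app X)) X))

/-- Enriched functors are the locally nonexpanding ones. -/
def IsEnriched (C : Type u₁) [Category.{v₁} C] [MetEnriched C]
    (K : Type u) [Category.{v} K] [MetEnriched K] : ObjectProperty (C ⥤ K) :=
  fun F => ∀ ⦃X Y : C⦄ (f g : X ⟶ Y), edist (F.map f) (F.map g) ≤ edist f g

/-- The enriched category `[C, K]` of enriched functors and natural transformations. -/
abbrev EnrichedFunctor (C : Type u₁) [Category.{v₁} C] [MetEnriched C]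
    (K : Type u) [Category.{v} K] [MetEnriched K] :=
  (IsEnriched C K).FullSubcategory

section

variable {K : Type u} [Category.{v} K] [MetEnriched K]

/-- The hom-space `K(X, Y)`. -/
abbrev homSpace (X Y : K) : Met.{v} := ⟨X ⟶ Y⟩

/-- Precomposition `K(Y, Z) → K(X, Z)`. -/
def precomp {X Y : K} (f : X ⟶ Y) (Z : K) : homSpace Y Z ⟶ homSpace X Z where
  toFun g := f ≫ g
  nonexpanding g g' := by
    refine (MetEnriched.edist_comp_le (K := K) f f g g').trans_eq ?_
    rw [edist_self, zero_add]

/-- Postcomposition `K(X, Y) → K(X, Z)`. -/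
def postcomp (X : K) {Y Z : K} (g : Y ⟶ Z) : homSpace X Y ⟶ homSpace X Z where
  toFun f := f ≫ g
  nonexpanding f f' := by
    refine (MetEnriched.edist_comp_le (K := K) f f' g g).trans_eq ?_
    rw [edist_self, add_zero]

/-- The contravariant hom-functors `K(-, Z)`, as a functor of `Z`. -/
def homFunctor (K : Type u) [Category.{v} K] [MetEnriched K] : K ⥤ (Kᵒᵖ ⥤ Met.{v}) where
  obj Z :=
    { obj := fun X => homSpace X.unop Z
      map := fun f => precomp f.unop Z
      map_id := fun X => Met.hom_ext fun g => Category.id_comp (obj := K) g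
      map_comp := fun f f' => Met.hom_ext fun g => Category.assoc (obj := K) _ _ g }
  map h :=
    { app := fun X => postcomp X.unop h
      naturality := fun X Y f => Met.hom_ext fun g => Category.assoc (obj := K) f.unop g h }
  map_id Z := by
    ext X
    exact Category.comp_id (obj := K) _
  map_comp h h' := by
    ext X g
    exact (Category.assoc (obj := K) g h h').symm

/-! ### Weighted colimits -/

/-- The comparison map `K(C, X) → [Dᵒᵖ, Met](W, K(F -, X))` that the unit
`unit : W → K(F -, C)` induces by composition. -/
def weightedComparison {D : Type u₁} [Category.{v₁} D] {W : Dᵒᵖ ⥤ Met.{v}} {F : D ⥤ K} {C : K}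
    (unit : W ⟶ F.op ⋙ (homFunctor K).obj C) (X : K) (h : C ⟶ X) :
    W ⟶ F.op ⋙ (homFunctor K).obj X :=
  unit ≫ Functor.whiskerLeft F.op ((homFunctor K).map h)

/-- `C` with the unit `unit` is a colimit of `F : D ⥤ K` weighted by `W`: the comparison maps are
isomorphisms of metric spaces. All shapes `D` used here are discretely enriched, so that every
functor on `D` or `Dᵒᵖ` is enriched. -/
structure IsWeightedColimit {D : Type u₁} [Category.{v₁} D] (W : Dᵒᵖ ⥤ Met.{v}) (F : D ⥤ K)
    (C : K) (unit : W ⟶ F.op ⋙ (homFunctor K).obj C) : Prop where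
  bijective (X : K) : Function.Bijective (weightedComparison unit X)
  isometric (X : K) (h h' : C ⟶ X) :
    edist (weightedComparison unit X h) (weightedComparison unit X h') = edist h h'

/-- `K` has coequalizers of reflexive pairs; ordinary colimits are conical, that is, weighted by
the constant functor with the value the one-point space. -/
def HasReflexiveCoequalizers (K : Type u) [Category.{v} K] [MetEnriched K] : Prop :=
  ∀ (X Y : K) (f g : X ⟶ Y), IsReflexivePair f g →
    ∃ (C : K) (unit : (Functor.const _).obj Met.point ⟶
      (Limits.parallelPair f g).op ⋙ (homFunctor K).obj C),
      IsWeightedColimit _ (Limits.parallelPair f g) C unit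

end

/-! ### Basic diagrams and subregular epimorphisms -/

/-- Objects of the basic shape: all real numbers `ε ≥ 0`, and one more object `a`. -/
inductive Basic : Type
  | val (ε : ℝ≥0)
  | a

namespace Basic

/-- Morphisms of the basic shape: the chain of all `ε`, and two cocones with codomain `a`. -/
inductive Hom : Basic → Basic → Type
  | le {ε ε' : ℝ≥0} (h : ε ≤ ε') : Hom (val ε) (val ε')
  | l (ε : ℝ≥0) : Hom (val ε) a
  | r (ε : ℝ≥0) : Hom (val ε) a
  | idA : Hom a a

/-- Composition in the basic shape. -/
def Hom.comp : {x y z : Basic} → Hom x y → Hom y z → Hom x z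
  | _, _, _, .le h, .le h' => .le (h.trans h')
  | _, _, _, .le _, .l _ => .l _
  | _, _, _, .le _, .r _ => .r _
  | _, _, _, .l ε, .idA => .l ε
  | _, _, _, .r ε, .idA => .r ε
  | _, _, _, .idA, .idA => .idA

/-- The identities of the basic shape. -/
def Hom.id : (x : Basic) → Hom x x
  | .val _ => .le le_rfl
  | .a => .idA

instance : Category.{0} Basic where
  Hom := Hom
  id := Hom.id
  comp := Hom.comp
  id_comp f := by cases f <;> rfl
  comp_id f := by cases f <;> rfl
  assoc f g h := by cases f <;> cases g <;> cases h <;> rfl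

/-- The two-point pseudometric space `{0, 1}` with `d(0, 1) = ε`. -/
def TwoPoint (_ : ℝ≥0) : Type v := ULift.{v} Bool

noncomputable instance (ε : ℝ≥0) : PseudoEMetricSpace (TwoPoint.{v} ε) where
  edist x y := if ULift.down x = ULift.down y then 0 else (ε : ℝ≥0∞)
  edist_self x := by simp
  edist_comm x y := by simp only [eq_comm]
  edist_triangle x y z := by
    obtain ⟨x⟩ := x
    obtain ⟨y⟩ := y
    obtain ⟨z⟩ := z
    cases x <;> cases y <;> cases z <;> simp

/-- The point `0` (for `false`) or `1` (for `true`) of the two-point space. -/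
def TwoPoint.mk (ε : ℝ≥0) (b : Bool) : TwoPoint.{v} ε := ULift.up b

/-- The map of two-point spaces carried by the identity of `{0, 1}`. -/
def TwoPoint.map (ε' ε : ℝ≥0) (p : TwoPoint.{v} ε') : TwoPoint.{v} ε := TwoPoint.mk ε p.down

theorem TwoPoint.edist_map_le {ε ε' : ℝ≥0} (h : ε ≤ ε') (p q : TwoPoint.{v} ε') :
    edist (TwoPoint.map ε' ε p) (TwoPoint.map ε' ε q) ≤ edist p q := by
  change ite (p.down = q.down) 0 (ε : ℝ≥0∞) ≤ ite (p.down = q.down) 0 (ε' : ℝ≥0∞)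
  split_ifs
  · exact le_rfl
  · exact_mod_cast h

/-- The basic weight on objects: the one-point space at `a`, and `{0, 1}` with `d(0, 1) = ε` at
`ε`. For `ε = 0` the two points coincide, as they must in a metric space. -/
noncomputable def weightObj : Basic → Met.{v}
  | val ε => Met.reflection (TwoPoint.{v} ε)
  | a => Met.point

/-- The basic weight on morphisms: it is carried by the identity of `{0, 1}` on `ε ⟶ ε'`, and
picks out `0` on `l` and `1` on `r`. -/
noncomputable def weightMap : {x y : Basic} → Hom x y → (weightObj.{v} y ⟶ weightObj.{v} x)
  | _, _, .le (ε := ε) (ε' := ε') h =>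
    Met.reflectionMap (TwoPoint.map ε' ε) (TwoPoint.edist_map_le h)
  | _, _, .l ε =>
    Met.ofDiscrete (M := Met.reflection (TwoPoint.{v} ε))
      fun _ => SeparationQuotient.mk (TwoPoint.mk ε false)
  | _, _, .r ε =>
    Met.ofDiscrete (M := Met.reflection (TwoPoint.{v} ε))
      fun _ => SeparationQuotient.mk (TwoPoint.mk ε true)
  | _, _, .idA => 𝟙 _

theorem weightMap_id (x : Basic) : weightMap.{v} (Hom.id x) = 𝟙 (weightObj x) := by
  cases x with
  | val ε =>
    exact Met.reflectionMap_id (TwoPoint ε)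
  | a => rfl

theorem weightMap_comp {x y z : Basic} (f : Hom x y) (g : Hom y z) :
    weightMap.{v} (f.comp g) = weightMap g ≫ weightMap f := by
  cases f with
  | le h =>
    cases g with
    | le h' =>
      exact Met.reflectionMap_comp (TwoPoint.map _ _) (TwoPoint.edist_map_le h')
        (TwoPoint.map _ _) (TwoPoint.edist_map_le h)
    | l => exact Met.hom_ext fun _ => rfl
    | r => exact Met.hom_ext fun _ => rfl
  | l => cases g; exact (Category.id_comp _).symm
  | r => cases g; exact (Category.id_comp _).symm
  | idA => cases g; exact (Category.id_comp _).symm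

/-- The basic weight. -/
noncomputable def weight : Basicᵒᵖ ⥤ Met.{v} where
  obj x := weightObj x.unop
  map f := weightMap f.unop
  map_id x := weightMap_id x.unop
  map_comp f g := weightMap_comp g.unop f.unop

end Basic

section

variable {K : Type u} [Category.{v} K] [MetEnriched K]

/-- The colimit map `D a ⟶ C` of a basic colimit: the value of the unit at the only point of the
weight at `a`. -/
def colimitMap {D : Basic ⥤ K} {C : K}
    (unit : Basic.weight.{v} ⟶ D.op ⋙ (homFunctor K).obj C) : D.obj Basic.a ⟶ C :=
  (unit.app (op Basic.a)).toFun (PUnit.unit : PUnit.{v + 1})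

/-- A subregular epimorphism is the colimit map of some basic diagram `D`, that is, of the colimit
of `D` weighted by the basic weight. -/
inductive IsSubregularEpi : {X Y : K} → (X ⟶ Y) → Prop
  | mk (D : Basic ⥤ K) (C : K) (unit : Basic.weight.{v} ⟶ D.op ⋙ (homFunctor K).obj C)
      (h : IsWeightedColimit Basic.weight.{v} D C unit) : IsSubregularEpi (colimitMap unit)

/-! ### Tensors, copowers and generators -/

/-- The map `K(T, X) → Met(M, K(G, X))` induced by `η : M → K(G, T)`. -/
def tensorComparison {M : Met.{v}} {G T : K} (η : M ⟶ homSpace G T) (X : K) (h : T ⟶ X) :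
    M ⟶ homSpace G X :=
  η ≫ postcomp G h

/-- `T` with the unit `η : M → K(G, T)` is a tensor product `M ⊗ G`: composition with `η` is an
isomorphism of metric spaces between `K(T, X)` and `Met(M, K(G, X))`, for every `X`. -/
structure IsTensor (M : Met.{v}) (G T : K) (η : M ⟶ homSpace G T) : Prop where
  bijective (X : K) : Function.Bijective (tensorComparison η X)
  isometric (X : K) (h h' : T ⟶ X) :
    edist (tensorComparison η X h) (tensorComparison η X h') = edist h h'

/-- `G` has tensors: `M ⊗ G` exists for all spaces `M`. -/
def HasTensors (G : K) : Prop :=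
  ∀ M : Met.{v}, ∃ (T : K) (η : M ⟶ homSpace G T), IsTensor M G T η

/-- `C` with the injections `i` is the copower of `G` indexed by the set `S`: the tensor product
of the discrete space `S` with `G`. -/
def IsCopower (S : Type v) (G C : K) (i : S → (G ⟶ C)) : Prop :=
  IsTensor (Met.discrete S) G C (Met.ofDiscrete (M := homSpace G C) i)

/-- `G` is abstractly finite: every morphism from `G` to a copower of `G` factorizes through a
finite subcopower. -/
def IsAbstractlyFinite (G : K) : Prop :=
  ∀ (S : Type v) (C : K) (i : S → (G ⟶ C)), IsCopower S G C i → ∀ f : G ⟶ C,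
    ∃ (S' : Set S) (C' : K) (i' : S' → (G ⟶ C')) (j : C' ⟶ C) (f' : G ⟶ C'),
      S'.Finite ∧ IsCopower S' G C' i' ∧ (∀ s : S', i' s ≫ j = i s) ∧ f' ≫ j = f

/-- `G` is a subregular projective: morphisms from `G` factorize through all subregular
epimorphisms. -/
def IsSubregularProjective (G : K) : Prop :=
  ∀ ⦃X Y : K⦄ (e : X ⟶ Y), IsSubregularEpi e → ∀ f : G ⟶ Y, ∃ g : G ⟶ X, g ≫ e = f

/-- `G` is a subregular generator: it has tensors, and for every object `X` the evaluation
morphism `K(G, X) ⊗ G ⟶ X` (the one that corresponds to the identity of `K(G, X)`) is a subregular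
epimorphism. -/
def IsSubregularGenerator (G : K) : Prop :=
  HasTensors G ∧
    ∀ (X T : K) (η : homSpace G X ⟶ homSpace G T), IsTensor (homSpace G X) G T η →
      ∀ e : T ⟶ X, tensorComparison η X e = 𝟙 (homSpace G X) → IsSubregularEpi e

/-- A subvarietal generator: an abstractly finite subregular projective which is a subregular
generator. -/
def IsSubvarietalGenerator (G : K) : Prop :=
  IsSubregularGenerator G ∧ IsAbstractlyFinite G ∧ IsSubregularProjective G

/-- The objects which are finite copowers `n ⊗ G`, for `n ∈ ℕ`, of `G`. -/
def IsFiniteCopower (G : K) : ObjectProperty K :=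
  fun C => ∃ (n : ℕ) (i : ULift.{v} (Fin n) → (G ⟶ C)), IsCopower (ULift.{v} (Fin n)) G C i

/-! ### Density -/

/-- The restricted Yoneda functor `E : K ⥤ [Aᵒᵖ, Met]` of the full subcategory `A` on the objects
with the property `P`; it assigns to `X` the restriction of `K(-, X)` to `Aᵒᵖ`. -/
def restrictedYoneda (P : ObjectProperty K) :
    K ⥤ EnrichedFunctor P.FullSubcategoryᵒᵖ Met.{v} :=
  (IsEnriched P.FullSubcategoryᵒᵖ Met.{v}).lift
    (homFunctor K ⋙ (Functor.whiskeringLeft _ _ _).obj P.ι.op)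
    (fun Z X _ f g => iSup_le fun (h : X.unop.obj ⟶ Z) =>
      (MetEnriched.edist_comp_le f.unop.hom g.unop.hom h h).trans_eq
        ((congrArg _ (edist_self h)).trans (add_zero _)))

/-- The full subcategory on the objects with the property `P` is dense: the restricted Yoneda
functor is faithful in the enriched sense (it preserves the distances of parallel pairs) and
full. -/
def IsDenseSubcategory (P : ObjectProperty K) : Prop :=
  (∀ ⦃X Y : K⦄ (f f' : X ⟶ Y),
    edist f f' = edist ((restrictedYoneda P).map f) ((restrictedYoneda P).map f')) ∧
  (restrictedYoneda P).Full

end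

end MetCat

namespace MetCat

section

variable {K : Type u} [Category.{v} K] [MetEnriched K]

/-! Write `T = K(G, X) ⊗ G` with evaluation `e : T ⟶ X`. Precomposition with a subregular
epimorphism preserves distances, and distances of morphisms out of `T` are suprema over the points
of `K(G, X)`. As `e` is a subregular epimorphism, `G` detects distances of parallel pairs
(`IsSubregularGenerator.edist_eq`); since `G` is one of its own finite copowers, so does the
restricted Yoneda functor.

For fullness, let `σ` be a transformation from `EX` to `EY`. Its component at `G` is a nonexpanding
map `K(G, X) → K(G, Y)`, hence a morphism `f : T ⟶ Y`. The crux is that `q ≫ f = σ (q ≫ e)` for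
every `q : G ⟶ T`. The copower of `G` over the points of `K(G, X)` maps to `T` by a subregular
epimorphism (`IsTensor.isSubregularEpi`), so `q` lifts along it by projectivity, and the lift lies
in a finite subcopower by abstract finiteness (`exists_factorization`). There the equation follows
from naturality of `σ`, checked on the injections. As `σ` is nonexpanding, `f` then satisfies the
cocone inequalities satisfied by `e`, so `f = e ≫ g`; this `g` induces `σ` at `G`, and thus at all
finite copowers. -/

theorem edist_comp_left_le {X Y Z : K} (f : X ⟶ Y) (g g' : Y ⟶ Z) :
    edist (f ≫ g) (f ≫ g') ≤ edist g g' :=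
  (precomp f Z).nonexpanding g g'

/-! ### Cocones weighted by the basic weight -/

namespace Basic

/-- The morphism `l` of the basic shape. -/
abbrev inl (ε : ℝ≥0) : val ε ⟶ a := Hom.l ε

/-- The morphism `r` of the basic shape. -/
abbrev inr (ε : ℝ≥0) : val ε ⟶ a := Hom.r ε

/-- The morphisms `ε ⟶ ε'` of the basic shape. -/
abbrev ofLE {ε ε' : ℝ≥0} (h : ε ≤ ε') : val ε ⟶ val ε' := Hom.le h

/-- The points `0` and `1` of the basic weight at `ε`. -/
noncomputable def pt (ε : ℝ≥0) (b : Bool) : weight.{v}.obj (op (val ε)) :=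
  (SeparationQuotient.mk (TwoPoint.mk ε b) : SeparationQuotient (TwoPoint.{v} ε))

theorem pt_surjective (ε : ℝ≥0) (w : weight.{v}.obj (op (val ε))) : ∃ b, w = pt ε b := by
  change SeparationQuotient (TwoPoint.{v} ε) at w
  induction w using Quotient.inductionOn with | _ w =>
  exact ⟨w.down, rfl⟩

theorem edist_pt_le (ε : ℝ≥0) : edist (pt.{v} ε false) (pt ε true) ≤ ε := by
  change edist (SeparationQuotient.mk (TwoPoint.mk.{v} ε false))
    (SeparationQuotient.mk (TwoPoint.mk ε true)) ≤ _
  rw [SeparationQuotient.edist_mk]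
  exact (if_neg (by simp [TwoPoint.mk])).le

/-- The condition on a morphism from `D a` to be the value at the point of a weighted cocone. -/
def IsCoconeMap (D : Basic ⥤ K) {Z : K} (f : D.obj a ⟶ Z) : Prop :=
  ∀ ε : ℝ≥0, edist (D.map (inl ε) ≫ f) (D.map (inr ε) ≫ f) ≤ ε

/-- The component at `ε` of the weighted cocone with a given value at the point. -/
noncomputable def coconeApp (D : Basic ⥤ K) {Z : K} (f : D.obj a ⟶ Z) (hf : IsCoconeMap D f)
    (ε : ℝ≥0) : Met.reflection (TwoPoint.{v} ε) ⟶ homSpace (D.obj (val ε)) Z :=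
  -- This inequality on the pseudometric space gives both the descent to the quotient (the two
  -- values agree if `ε = 0`) and nonexpansion.
  have key : ∀ p q : TwoPoint.{v} ε,
      edist (bif p.down then D.map (inr ε) ≫ f else D.map (inl ε) ≫ f)
        (bif q.down then D.map (inr ε) ≫ f else D.map (inl ε) ≫ f) ≤ edist p q := by
    rintro ⟨p⟩ ⟨q⟩
    change _ ≤ ite (p = q) 0 (ε : ℝ≥0∞)
    cases p <;> cases q
    · simp
    · simpa using hf ε
    · simpa [edist_comm] using hf ε
    · simp
  { toFun := SeparationQuotient.lift
      (fun p => bif p.down then D.map (inr ε) ≫ f else D.map (inl ε) ≫ f)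
      (fun p q h => edist_le_zero.1 ((key p q).trans (EMetric.inseparable_iff.1 h).le))
    nonexpanding := fun x y => by
      induction x using Quotient.inductionOn with | _ x =>
      induction y using Quotient.inductionOn with | _ y =>
      exact key x y }

/-- The weighted cocone with a given value at the point. -/
noncomputable def cocone (D : Basic ⥤ K) {Z : K} (f : D.obj a ⟶ Z) (hf : IsCoconeMap D f) :
    weight.{v} ⟶ D.op ⋙ (homFunctor K).obj Z where
  app x := match x with
    | ⟨val ε⟩ => coconeApp D f hf ε
    | ⟨a⟩ => Met.ofDiscrete (M := homSpace (D.obj a) Z) fun _ => f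
  naturality := by
    rintro ⟨x⟩ ⟨y⟩ ⟨k⟩
    change Basic.Hom y x at k
    cases k with
    | @le ε ε' h =>
      refine Met.hom_ext fun w => ?_
      obtain ⟨b, rfl⟩ := pt_surjective _ w
      cases b
      · change D.map (inl ε) ≫ f = D.map (ofLE h) ≫ D.map (inl ε') ≫ f
        rw [← Category.assoc, ← D.map_comp]; rfl
      · change D.map (inr ε) ≫ f = D.map (ofLE h) ≫ D.map (inr ε') ≫ f
        rw [← Category.assoc, ← D.map_comp]; rfl
    | l ε => exact Met.hom_ext fun w => rfl
    | r ε => exact Met.hom_ext fun w => rfl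
    | idA =>
      refine Met.hom_ext fun w => ?_
      change f = D.map (𝟙 a) ≫ f
      rw [D.map_id, Category.id_comp]

variable {D : Basic ⥤ K} {Z : K}

theorem app_pt_false (τ : weight.{v} ⟶ D.op ⋙ (homFunctor K).obj Z) (ε : ℝ≥0) :
    (τ.app (op (val ε))).toFun (pt ε false) = D.map (inl ε) ≫ colimitMap τ :=
  congrFun (congrArg Met.Hom.toFun (τ.naturality (inl ε).op)) (PUnit.unit : PUnit.{v + 1})

theorem app_pt_true (τ : weight.{v} ⟶ D.op ⋙ (homFunctor K).obj Z) (ε : ℝ≥0) :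
    (τ.app (op (val ε))).toFun (pt ε true) = D.map (inr ε) ≫ colimitMap τ :=
  congrFun (congrArg Met.Hom.toFun (τ.naturality (inr ε).op)) (PUnit.unit : PUnit.{v + 1})

/-- The points `0` and `1` are at distance at most `ε`, the component at `ε` is nonexpanding, and
naturality at `l` and `r` identifies its two values. -/
theorem isCoconeMap_colimitMap (τ : weight.{v} ⟶ D.op ⋙ (homFunctor K).obj Z) :
    IsCoconeMap D (colimitMap τ) := fun ε => by
  rw [← app_pt_false, ← app_pt_true]
  exact ((τ.app (op (val ε))).nonexpanding _ _).trans (edist_pt_le ε)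

/-- The weight at `ε` consists of the images of the point at `a` under `l` and `r`. The other
components are therefore composites with the value at `a`, and composing cannot increase distances.
-/
theorem edist_cocone (τ τ' : weight.{v} ⟶ D.op ⋙ (homFunctor K).obj Z) :
    edist τ τ' = edist (colimitMap τ) (colimitMap τ') := by
  apply le_antisymm
  · refine iSup_le fun x => iSup_le fun w => ?_
    obtain ⟨x⟩ := x
    cases x with
    | val ε =>
      obtain ⟨b, rfl⟩ := pt_surjective _ w
      cases b
      · rw [app_pt_false, app_pt_false]
        exact edist_comp_left_le _ _ _
      · rw [app_pt_true, app_pt_true]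
        exact edist_comp_left_le _ _ _
    | a => exact le_rfl
  · exact (le_iSup (fun w => edist ((τ.app (op a)).toFun w) ((τ'.app (op a)).toFun w))
      (PUnit.unit : PUnit.{v + 1})).trans
      (le_iSup (fun x => edist (τ.app x) (τ'.app x)) (op a))

theorem cocone_ext {τ τ' : weight.{v} ⟶ D.op ⋙ (homFunctor K).obj Z}
    (h : colimitMap τ = colimitMap τ') : τ = τ' := by
  rw [← edist_eq_zero, edist_cocone, h, edist_self]

end Basic

/-! ### Subregular epimorphisms -/

/-- A morphism from `D a` with the universal property of the colimit is a subregular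
epimorphism. -/
theorem isSubregularEpi_of_universal (D : Basic ⥤ K) {C : K} (e : D.obj Basic.a ⟶ C)
    (he : Basic.IsCoconeMap D e)
    (isometric : ∀ (X : K) (h h' : C ⟶ X), edist (e ≫ h) (e ≫ h') = edist h h')
    (desc : ∀ (X : K) (f : D.obj Basic.a ⟶ X), Basic.IsCoconeMap D f → ∃ h, e ≫ h = f) :
    IsSubregularEpi e := by
  have iso (X : K) (h h' : C ⟶ X) :
      edist (weightedComparison (Basic.cocone D e he) X h)
        (weightedComparison (Basic.cocone D e he) X h') = edist h h' := by
    rw [Basic.edist_cocone]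
    exact isometric X h h'
  refine IsSubregularEpi.mk D C (Basic.cocone D e he) ⟨fun X => ⟨fun h h' hh => ?_, fun τ => ?_⟩, iso⟩
  -- Injectivity is the isometry at distance `0`.
  · rw [← edist_eq_zero, ← iso, hh, edist_self]
  · obtain ⟨h, hh⟩ := desc X _ (Basic.isCoconeMap_colimitMap τ)
    exact ⟨h, Basic.cocone_ext hh⟩

theorem IsSubregularEpi.edist_comp {X Y : K} {e : X ⟶ Y} (he : IsSubregularEpi e) {Z : K}
    (h h' : Y ⟶ Z) : edist (e ≫ h) (e ≫ h') = edist h h' := by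
  obtain ⟨D, C, unit, hC⟩ := he
  rw [← hC.isometric, Basic.edist_cocone]
  rfl

/-- The basic diagram of `e` is hidden, so the hypothesis ranges over all pairs into `X`; it is
applied to the images of `l` and `r`, which `e` brings within `ε` of each other. -/
theorem IsSubregularEpi.desc {X Y : K} {e : X ⟶ Y} (he : IsSubregularEpi e) {Z : K} (f : X ⟶ Z)
    (hf : ∀ (W : K) (p q : W ⟶ X), edist (p ≫ f) (q ≫ f) ≤ edist (p ≫ e) (q ≫ e)) :
    ∃ g : Y ⟶ Z, e ≫ g = f := by
  obtain ⟨D, C, unit, hC⟩ := he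
  have hf' : Basic.IsCoconeMap D f := fun ε =>
    (hf _ _ _).trans (Basic.isCoconeMap_colimitMap unit ε)
  obtain ⟨g, hg⟩ := (hC.bijective Z).2 (Basic.cocone D f hf')
  exact ⟨g, congrArg colimitMap hg⟩

/-! ### Tensors -/

namespace IsTensor

variable {M : Met.{v}} {G T : K} {η : M ⟶ homSpace G T}

theorem exists_desc (hT : IsTensor M G T η) {X : K} (φ : M ⟶ homSpace G X) :
    ∃ h : T ⟶ X, ∀ m, η.toFun m ≫ h = φ.toFun m := by
  obtain ⟨h, hh⟩ := (hT.bijective X).2 φ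
  exact ⟨h, fun m => congrFun (congrArg Met.Hom.toFun hh) m⟩

theorem edist_eq (hT : IsTensor M G T η) {X : K} (h h' : T ⟶ X) :
    edist h h' = ⨆ m, edist (η.toFun m ≫ h) (η.toFun m ≫ h') :=
  (hT.isometric X h h').symm

theorem hom_ext (hT : IsTensor M G T η) {X : K} {h h' : T ⟶ X}
    (w : ∀ m, η.toFun m ≫ h = η.toFun m ≫ h') : h = h' :=
  (hT.bijective X).1 (Met.hom_ext w)

end IsTensor

namespace IsCopower

variable {S : Type v} {G C : K} {i : S → (G ⟶ C)}

theorem edist_eq (hC : IsCopower S G C i) {X : K} (h h' : C ⟶ X) :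
    edist h h' = ⨆ s, edist (i s ≫ h) (i s ≫ h') :=
  IsTensor.edist_eq hC h h'

theorem hom_ext (hC : IsCopower S G C i) {X : K} {h h' : C ⟶ X}
    (w : ∀ s, i s ≫ h = i s ≫ h') : h = h' :=
  IsTensor.hom_ext hC w

theorem exists_desc (hC : IsCopower S G C i) {X : K} (f : S → (G ⟶ X)) :
    ∃ h : C ⟶ X, ∀ s, i s ≫ h = f s :=
  IsTensor.exists_desc hC (Met.ofDiscrete (M := homSpace G X) f)

end IsCopower

/-- Copowers may be indexed by any set of the same cardinality. -/
theorem IsCopower.reindex {S S' : Type v} {G C : K} {i : S → (G ⟶ C)} (hC : IsCopower S G C i)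
    (σ : S' ≃ S) : IsCopower S' G C (i ∘ σ) where
  bijective X := by
    refine ⟨fun h h' hh => hC.hom_ext fun s => ?_, fun φ => ?_⟩
    · have := congrFun (congrArg Met.Hom.toFun hh) (σ.symm s)
      change i (σ (σ.symm s)) ≫ h = i (σ (σ.symm s)) ≫ h' at this
      rwa [σ.apply_symm_apply] at this
    · obtain ⟨h, hh⟩ := hC.exists_desc fun s => φ.toFun (σ.symm s)
      refine ⟨h, Met.hom_ext fun s => (hh (σ s)).trans ?_⟩
      exact congrArg φ.toFun (σ.symm_apply_apply s)
  isometric X h h' :=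
    (σ.iSup_comp (g := fun s => edist (i s ≫ h) (i s ≫ h'))).trans
      (hC.edist_eq h h').symm

/-- Abstract finiteness yields copowers over finite subsets; this places them in the subcategory
indexed by `n`. -/
theorem IsCopower.isFiniteCopower {S : Type v} [Finite S] {G C : K} {i : S → (G ⟶ C)}
    (hC : IsCopower S G C i) : IsFiniteCopower G C :=
  ⟨Nat.card S, _, hC.reindex (Equiv.ulift.trans (Finite.equivFin S).symm)⟩

theorem isCopower_self (G : K) : IsCopower PUnit.{v + 1} G G fun _ => 𝟙 G where
  bijective X := by
    refine ⟨fun h h' hh => ?_, fun φ => ⟨φ.toFun PUnit.unit, Met.hom_ext fun _ => ?_⟩⟩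
    · have := congrFun (congrArg Met.Hom.toFun hh) PUnit.unit
      change 𝟙 G ≫ h = 𝟙 G ≫ h' at this
      simpa using this
    · exact Category.id_comp (obj := K) _
  isometric X h h' := by
    change (⨆ _ : PUnit.{v + 1}, edist (𝟙 G ≫ h) (𝟙 G ≫ h')) = _
    simp

theorem isFiniteCopower_self (G : K) : IsFiniteCopower G G :=
  (isCopower_self G).isFiniteCopower

/-! ### The canonical presentation of a tensor product -/

/-- The pairs of points at distance at most `ε`. -/
abbrev ClosePairs (M : Met.{v}) (ε : ℝ≥0) : Type v := {p : M × M // edist p.1 p.2 ≤ ε}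

/-- The index sets of the copowers in the canonical presentation. -/
def presentationObj (M : Met.{v}) : Basic → Type v
  | .val ε => ClosePairs M ε
  | .a => M

/-- The maps of index sets in the canonical presentation. -/
def presentationMap (M : Met.{v}) :
    {x y : Basic} → Basic.Hom x y → presentationObj M x → presentationObj M y
  | _, _, .le h => fun p => ⟨p.1, p.2.trans (by exact_mod_cast h)⟩
  | _, _, .l _ => fun p => p.1.1
  | _, _, .r _ => fun p => p.1.2
  | _, _, .idA => fun m => m

/-- The copower of an object with tensors. -/
noncomputable def copower {G : K} (hG : HasTensors G) (S : Type v) : K :=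
  (hG (Met.discrete S)).choose

/-- The injections of the copower. -/
noncomputable def copowerInj {G : K} (hG : HasTensors G) {S : Type v} (s : S) :
    G ⟶ copower hG S :=
  (hG (Met.discrete S)).choose_spec.choose.toFun s

theorem isCopower_copower {G : K} (hG : HasTensors G) (S : Type v) :
    IsCopower S G (copower hG S) (copowerInj hG) :=
  (hG (Met.discrete S)).choose_spec.choose_spec

theorem copower_hom_ext {G : K} (hG : HasTensors G) {S : Type v} {X : K}
    {h h' : copower hG S ⟶ X} (w : ∀ s, copowerInj hG s ≫ h = copowerInj hG s ≫ h') : h = h' :=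
  (isCopower_copower hG S).hom_ext w

/-- The morphism from the copower given by a family of morphisms. -/
noncomputable def copowerDesc {G : K} (hG : HasTensors G) {S : Type v} {X : K} (f : S → (G ⟶ X)) :
    copower hG S ⟶ X :=
  ((isCopower_copower hG S).exists_desc f).choose

@[simp]
theorem copowerInj_desc {G : K} (hG : HasTensors G) {S : Type v} {X : K} (f : S → (G ⟶ X))
    (s : S) : copowerInj hG s ≫ copowerDesc hG f = f s :=
  ((isCopower_copower hG S).exists_desc f).choose_spec s

@[simp]
theorem copowerInj_desc_assoc {G : K} (hG : HasTensors G) {S : Type v} {X Y : K}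
    (f : S → (G ⟶ X)) (s : S) (g : X ⟶ Y) :
    copowerInj hG s ≫ copowerDesc hG f ≫ g = f s ≫ g := by
  rw [← Category.assoc, copowerInj_desc]

/-- The canonical presentation of the tensor product `M ⊗ G`: the basic diagram of the copowers
indexed by the pairs of points at distance at most `ε`, and by the points. -/
noncomputable def presentation {G : K} (hG : HasTensors G) (M : Met.{v}) : Basic ⥤ K where
  obj x := copower hG (presentationObj M x)
  map k := copowerDesc hG fun s => copowerInj hG (presentationMap M k s)
  map_id x := copower_hom_ext hG fun s => by
    rw [copowerInj_desc, Category.comp_id]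
    cases x <;> rfl
  map_comp {x y z} k k' := copower_hom_ext hG fun s => by
    rw [copowerInj_desc, copowerInj_desc_assoc, copowerInj_desc]
    change Basic.Hom x y at k
    change Basic.Hom y z at k'
    cases k <;> cases k' <;> rfl

/-- Consequently the cocone condition at `ε` says that `f` sends points at distance at most `ε` to
morphisms at distance at most `ε`. -/
theorem edist_presentation {G : K} (hG : HasTensors G) (M : Met.{v}) (ε : ℝ≥0) {X : K}
    (f : copower hG M ⟶ X) :
    edist ((presentation hG M).map (Basic.inl ε) ≫ f) ((presentation hG M).map (Basic.inr ε) ≫ f) =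
      ⨆ p : ClosePairs M ε, edist (copowerInj hG p.1.1 ≫ f) (copowerInj hG p.1.2 ≫ f) :=
  ((isCopower_copower hG (ClosePairs M ε)).edist_eq _ _).trans (iSup_congr fun p =>
    congrArg₂ edist (copowerInj_desc_assoc hG _ p f) (copowerInj_desc_assoc hG _ p f))

/-- The canonical morphism from the copower indexed by the points of `M` to `M ⊗ G` is a
subregular epimorphism. -/
theorem IsTensor.isSubregularEpi {M : Met.{v}} {G T : K} {η : M ⟶ homSpace G T}
    (hT : IsTensor M G T η) (hG : HasTensors G) :
    IsSubregularEpi (copowerDesc hG fun m : M => η.toFun m) := by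
  refine isSubregularEpi_of_universal (presentation hG M) _ (fun ε => ?_) (fun X h h' => ?_)
    fun X f hf => ?_
  · refine (edist_presentation hG M ε _).trans_le (iSup_le fun p => ?_)
    rw [copowerInj_desc, copowerInj_desc]
    exact (η.nonexpanding _ _).trans p.2
  · refine ((isCopower_copower hG M).edist_eq _ _).trans
      (Eq.trans ?_ (hT.edist_eq h h').symm)
    refine iSup_congr fun m => ?_
    exact congrArg₂ edist (copowerInj_desc_assoc hG _ m h) (copowerInj_desc_assoc hG _ m h')
  · let φ : M ⟶ homSpace G X :=
      { toFun := fun m => copowerInj hG m ≫ f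
        nonexpanding := fun m m' => by
          -- An infinite distance imposes no condition; for a finite one the cocone condition is
          -- used at `ε = edist m m'` itself.
          by_cases hm : edist m m' = ⊤
          · exact hm ▸ le_top
          · lift edist m m' to ℝ≥0 using hm with ε hε
            exact (le_iSup (fun p : ClosePairs M ε =>
              edist (copowerInj hG p.1.1 ≫ f) (copowerInj hG p.1.2 ≫ f)) ⟨(m, m'), hε.ge⟩).trans
              ((edist_presentation hG M ε f).symm.trans_le (hf ε)) }
    obtain ⟨h, hh⟩ := hT.exists_desc φ
    refine ⟨h, copower_hom_ext hG fun m => ?_⟩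
    exact (copowerInj_desc_assoc hG _ m h).trans (hh m)

/-! ### Density of the finite copowers of a subvarietal generator -/

/-- Distances of parallel pairs are detected by a subregular generator. -/
theorem IsSubregularGenerator.edist_eq {G : K} (hG : IsSubregularGenerator G) {X Y : K}
    (f f' : X ⟶ Y) : edist f f' = ⨆ p : G ⟶ X, edist (p ≫ f) (p ≫ f') := by
  obtain ⟨T, η, hT⟩ := hG.1 (homSpace G X)
  obtain ⟨e, he⟩ := (hT.bijective X).2 (𝟙 (homSpace G X))
  have hp (p : G ⟶ X) : η.toFun p ≫ e = p := congrFun (congrArg Met.Hom.toFun he) p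
  -- Pass from `X` to the tensor product along the evaluation, where distances are suprema over the
  -- points `p : G ⟶ X`.
  rw [← (hG.2 X T η hT e he).edist_comp, hT.edist_eq]
  refine iSup_congr fun p => ?_
  rw [← Category.assoc, ← Category.assoc, hp]

/-- Morphisms from `G` to `M ⊗ G` factorize through a finite copower of `G`, the injections of
which are sent to values of the unit. -/
theorem IsSubvarietalGenerator.exists_factorization {G : K} (hG : IsSubvarietalGenerator G)
    {M : Met.{v}} {T : K} {η : M ⟶ homSpace G T} (hT : IsTensor M G T η) (q : G ⟶ T) :
    ∃ (S : Set M) (C : K) (i : S → (G ⟶ C)) (q' : G ⟶ C) (j : C ⟶ T), S.Finite ∧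
      IsCopower S G C i ∧ (∀ s : S, i s ≫ j = η.toFun s) ∧ q' ≫ j = q := by
  have hTen := hG.1.1
  -- Projectivity lifts `q` to the copower over the points of `M`; abstract finiteness then cuts
  -- this copower down to a finite one.
  obtain ⟨q₀, hq₀⟩ := hG.2.2 _ (hT.isSubregularEpi hTen) q
  obtain ⟨S, C, i, j, q', hS, hC, hj, hq'⟩ := hG.2.1 M _ _ (isCopower_copower hTen M) q₀
  refine ⟨S, C, i, q', j ≫ copowerDesc hTen fun m : M => η.toFun m, hS, hC, fun s => ?_, ?_⟩
  · rw [← Category.assoc, hj, copowerInj_desc]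
  · rw [← Category.assoc, hq', hq₀]

theorem IsSubvarietalGenerator.edist_restrictedYoneda {G : K} (hG : IsSubvarietalGenerator G)
    {X Y : K} (f f' : X ⟶ Y) :
    edist f f' = edist ((restrictedYoneda (IsFiniteCopower G)).map f)
      ((restrictedYoneda (IsFiniteCopower G)).map f') := by
  change _ = ⨆ A : (IsFiniteCopower G).FullSubcategoryᵒᵖ, ⨆ p : A.unop.obj ⟶ X,
    edist (p ≫ f) (p ≫ f')
  apply le_antisymm
  · rw [hG.1.edist_eq]
    exact le_iSup (fun A : (IsFiniteCopower G).FullSubcategoryᵒᵖ => ⨆ p : A.unop.obj ⟶ X,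
      edist (p ≫ f) (p ≫ f')) (op ⟨G, isFiniteCopower_self G⟩)
  · exact iSup_le fun A => iSup_le fun p => edist_comp_left_le p f f'

theorem IsSubvarietalGenerator.full_restrictedYoneda {G : K} (hG : IsSubvarietalGenerator G) :
    (restrictedYoneda (IsFiniteCopower G)).Full where
  map_surjective {X Y} σ := by
    let act {A : K} (hA : IsFiniteCopower G A) (p : A ⟶ X) : A ⟶ Y :=
      (σ.hom.app (op ⟨A, hA⟩)).toFun p
    have act_comp {A B : K} (hA : IsFiniteCopower G A) (hB : IsFiniteCopower G B) (k : A ⟶ B)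
        (p : B ⟶ X) : act hA (k ≫ p) = k ≫ act hB p :=
      congrFun (congrArg Met.Hom.toFun (σ.hom.naturality
        (Quiver.Hom.op (ObjectProperty.homMk k : (⟨A, hA⟩ : (IsFiniteCopower G).FullSubcategory) ⟶
          ⟨B, hB⟩)))) p
    have hGG := isFiniteCopower_self G
    obtain ⟨T, η, hT⟩ := hG.1.1 (homSpace G X)
    obtain ⟨e, he⟩ := (hT.bijective X).2 (𝟙 (homSpace G X))
    have hp (p : G ⟶ X) : η.toFun p ≫ e = p := congrFun (congrArg Met.Hom.toFun he) p
    -- The component of `σ` at `G` is nonexpanding, so it has a transpose out of the tensor product.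
    obtain ⟨f, hf⟩ := hT.exists_desc (σ.hom.app (op ⟨G, hGG⟩))
    replace hf (p : G ⟶ X) : η.toFun p ≫ f = act hGG p := hf p
    have key (q : G ⟶ T) : q ≫ f = act hGG (q ≫ e) := by
      obtain ⟨S, C, i, q', j, hS, hC, hj, rfl⟩ := hG.exists_factorization hT q
      have : Finite S := hS
      have hCf := hC.isFiniteCopower
      -- Unlike `T`, the finite copower `C` lies in the subcategory, so `σ` acts on `j ≫ e`; by
      -- naturality both sides agree on each injection.
      have hjf : j ≫ f = act hCf (j ≫ e) := hC.hom_ext fun s => by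
        rw [← act_comp hGG hCf, ← Category.assoc, ← Category.assoc, hj, hf, hp]
      rw [Category.assoc, Category.assoc, act_comp hGG hCf, hjf]
    obtain ⟨g, hg⟩ := (hG.1.2 X T η hT e he).desc f fun W p q => by
      -- Tested on `k : G ⟶ W`, both composites with `f` become values of the nonexpanding component
      -- of `σ` at `G`.
      rw [hG.1.edist_eq]
      refine iSup_le fun k => ?_
      rw [← Category.assoc, ← Category.assoc, key, key]
      refine ((σ.hom.app (op ⟨G, hGG⟩)).nonexpanding _ _).trans ?_
      rw [Category.assoc, Category.assoc]
      exact edist_comp_left_le k _ _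
    have hact (p : G ⟶ X) : p ≫ g = act hGG p := by
      rw [← hf, ← hg, ← Category.assoc, hp]
    refine ⟨g, ObjectProperty.hom_ext _ (NatTrans.ext (funext fun A => Met.hom_ext fun p => ?_))⟩
    obtain ⟨⟨A, hA⟩⟩ := A
    change A ⟶ X at p
    change p ≫ g = act hA p
    -- `id` keeps `hA` itself, on which the goal depends.
    obtain ⟨n, i, hi⟩ := id hA
    refine hi.hom_ext fun s => ?_
    rw [← act_comp hGG hA, ← Category.assoc, hact]

end

end MetCat

theorem theoremT {K : Type u} [Category.{v} K] [MetCat.MetEnriched K]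
    (hK : MetCat.HasReflexiveCoequalizers K) (G : K) (hG : MetCat.IsSubvarietalGenerator G) :
    MetCat.IsDenseSubcategory (MetCat.IsFiniteCopower G) := by
  exact ⟨fun _ _ f f' => hG.edist_restrictedYoneda f f', hG.full_restrictedYoneda⟩
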